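/- Let $M$ be a connected smooth manifold (Hausdorff, second countable, without boundary) of dimension $n\ge 2$, equipped with an $\operatorname{SL}(n,\mathbb{R})$-structure, i.e. a volume element $\omega$: a smooth, nowhere vanishing $n$-form. Orient $M$ by $\omega$, so that a frame $v=(v_1,\dots,v_n)$ of $T_xM$ is positive if $\omega_x(v)>0$; an $n$-form is called positive (negative, nonnegative, nonpositive) if its values on all positive frames at all points of $M$ are $>0$ ($<0$, $\ge 0$, $\le 0$). Let $\phi_t$ be a (local or global) smooth flow on $M$ whose velocity field $\xi$ is smooth and has compact support, and let $L_\xi\omega=\frac{d}{dt}(\phi_t^*\omega)|_{t=0}=(\operatorname{div}_\omega\xi)\,\omega$ be its rate of volumetric expansion. Then: 1. $\omega$ cannot increase and cannot decrease along the trajectories of the flow: $L_\xi\omega$ is neither positive nor negative, and it is impossible that for every $x\in M$ and every positive frame $v$ at $x$ the function $t\mapsto(\phi_t^*\omega)_x(v)$ is strictly increasing on the interval of times where $\phi_t(x)$ is defined; likewise with "strictly decreasing". 2. If $\omega$ is nondecreasing along the trajectories of the flow, in the sense that $L_\xi\omega$ is nonnegative, or in the sense that $t\mapsto(\phi_t^*\omega)_x(v)$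 is nondecreasing for every $x\in M$ and every positive frame $v$ at $x$, or if $\omega$ is nonincreasing in either of the corresponding senses, then the flow is incompressible, i.e. $(\phi_t^*\omega)_x=\omega_x$ whenever $\phi_t(x)$ is defined, and its rate of volumetric expansion vanishes: $L_\xi\omega=0$ and $\operatorname{div}_\omega\xi=0$ on $M$. -/

import Mathlib

open scoped Manifold ContDiff

noncomputable section

namespace VolumetricFlow

/-- A (not necessarily smooth) differential form of degree `k` on an `n`-dimensional manifold. -/
abbrev DiffForm (n k : ℕ) (M : Type*) [TopologicalSpace M]
    [ChartedSpace (EuclideanSpace ℝ (Fin n)) M] : Type _ :=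
  ∀ x : M, (TangentSpace (𝓡 n) x) [⋀^Fin k]→L[ℝ] ℝ

section

variable {n k : ℕ} {M : Type*} [TopologicalSpace M]
  [ChartedSpace (EuclideanSpace ℝ (Fin n)) M]

/-- The representation of a form in the local coordinates given by the preferred chart at `x₀`:
its pullback under the inverse chart. -/
def localForm (vol : DiffForm n k M) (x₀ : M) (y : EuclideanSpace ℝ (Fin n)) :
    (EuclideanSpace ℝ (Fin n)) [⋀^Fin k]→L[ℝ] ℝ :=
  (vol ((extChartAt (𝓡 n) x₀).symm y)).compContinuousLinearMap
    (mfderiv 𝓘(ℝ, EuclideanSpace ℝ (Fin n)) (𝓡 n) (extChartAt (𝓡 n) x₀).symm y)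

/-- A form is smooth if all its local representations are smooth. -/
def IsSmoothForm (vol : DiffForm n k M) : Prop :=
  ∀ x₀ : M, ContDiffOn ℝ ∞ (localForm vol x₀) (extChartAt (𝓡 n) x₀).target

/-- A volume element (equivalently, an `SL(n, ℝ)`-structure): a smooth form of top degree which
vanishes nowhere. -/
structure IsVolumeForm (vol : DiffForm n n M) : Prop where
  smooth : IsSmoothForm vol
  ne_zero : ∀ x, vol x ≠ 0

/-- A smooth vector field. -/
def IsSmoothVectorField [IsManifold (𝓡 n) ∞ M] (ξ : ∀ x : M, TangentSpace (𝓡 n) x) : Prop :=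
  ContMDiff (𝓡 n) (𝓡 n).tangent ∞ (fun x => (⟨x, ξ x⟩ : TangentBundle (𝓡 n) M))

/-- The vector field `ξ` has compact support. -/
def IsCompactlySupported (ξ : ∀ x : M, TangentSpace (𝓡 n) x) : Prop :=
  IsCompact (closure {x : M | ξ x ≠ 0})

/-- The set of times at which the trajectory through `x` is defined, for a flow with domain
`D ⊆ ℝ × M`. -/
def times (D : Set (ℝ × M)) (x : M) : Set ℝ := {t | (t, x) ∈ D}

/-- `φ` is a (local) flow on `M` with domain `D` and velocity field `ξ`: a smooth local
one-parameter group of transformations, defined for each `x` on an open interval of times around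
`0`, whose trajectories `t ↦ φ t x` have velocity `ξ`. The values of `φ` off `D` are irrelevant;
a global flow is the case `D = Set.univ`. -/
structure IsFlow (D : Set (ℝ × M)) (φ : ℝ → M → M)
    (ξ : ∀ x : M, TangentSpace (𝓡 n) x) : Prop where
  isOpen_domain : IsOpen D
  zero_mem : ∀ x, (0, x) ∈ D
  interval : ∀ x, (times D x).OrdConnected
  smooth : ContMDiffOn (𝓘(ℝ, ℝ).prod (𝓡 n)) (𝓡 n) ∞ (fun p : ℝ × M => φ p.1 p.2) D
  map_zero : ∀ x, φ 0 x = x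
  map_add : ∀ s t x, (s, x) ∈ D → (t, φ s x) ∈ D → (t + s, x) ∈ D → φ (t + s) x = φ t (φ s x)
  velocity : ∀ x, IsMIntegralCurveOn (fun t => φ t x) ξ (times D x)

/-- The pullback `φ_t^* vol` at the point `x`. -/
def pullback (φ : ℝ → M → M) (vol : DiffForm n k M) (t : ℝ) : DiffForm n k M :=
  fun x => (vol (φ t x)).compContinuousLinearMap (mfderiv (𝓡 n) (𝓡 n) (φ t) x)

/-- The Lie derivative `d/dt (φ_t^* vol)` at `t = 0` along the flow `φ`. For `vol` a volume element it
is the rate of volumetric expansion. -/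
def lieDerivative (φ : ℝ → M → M) (vol : DiffForm n k M) : DiffForm n k M :=
  fun x => deriv (fun t : ℝ => pullback φ vol t x) 0

/-- The frame of `T_x M` given by the standard basis in the preferred chart at `x`. -/
def coordFrame (x : M) : Fin n → TangentSpace (𝓡 n) x :=
  fun i => (EuclideanSpace.basisFun (Fin n) ℝ i : EuclideanSpace ℝ (Fin n))

/-- The divergence (logarithmic rate of change of the volume): the function `div` with
`L_ξ vol = div • vol`. -/
def divergence (φ : ℝ → M → M) (vol : DiffForm n n M) (x : M) : ℝ :=
  lieDerivative φ vol x (coordFrame x) / vol x (coordFrame x)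

theorem eq_smul_of_topDegree (x : M) (α β : (TangentSpace (𝓡 n) x) [⋀^Fin n]→L[ℝ] ℝ)
    (hβ : β ≠ 0) : α = (α (coordFrame x) / β (coordFrame x)) • β := by
  let b : Module.Basis (Fin n) ℝ (TangentSpace (𝓡 n) x) :=
    (EuclideanSpace.basisFun (Fin n) ℝ).toBasis
  have hb : (⇑b : Fin n → TangentSpace (𝓡 n) x) = coordFrame x := by
    funext i
    exact congrFun (OrthonormalBasis.coe_toBasis (EuclideanSpace.basisFun (Fin n) ℝ)) i
  have key : ∀ (γ : (TangentSpace (𝓡 n) x) [⋀^Fin n]→L[ℝ] ℝ) (v : Fin n → TangentSpace (𝓡 n) x),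
      γ v = γ (coordFrame x) * b.det v := by
    intro γ v
    have h := congrArg (fun f => f v) (AlternatingMap.eq_smul_basis_det b γ.toAlternatingMap)
    rw [← hb]
    simpa using h
  have hne : β (coordFrame x) ≠ 0 := by
    intro h0
    apply hβ
    ext v
    rw [key β v, h0]
    simp
  ext v
  rw [ContinuousAlternatingMap.smul_apply, smul_eq_mul, key α v, key β v]
  field_simp

/-- The defining property of the divergence. -/
theorem lieDerivative_eq_divergence_smul (φ : ℝ → M → M) (vol : DiffForm n n M)
    (hvol : IsVolumeForm vol) (x : M) : lieDerivative φ vol x = divergence φ vol x • vol x :=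
  eq_smul_of_topDegree x _ _ (hvol.ne_zero x)

/-- A frame at `x` that is positive for the orientation of `M` given by `vol`. -/
def IsPositiveFrame (vol : DiffForm n n M) (x : M) (v : Fin n → TangentSpace (𝓡 n) x) : Prop :=
  0 < vol x v

/-- `α > 0`: the top degree form `α` is positive on all frames which are positive for `vol`. -/
def IsPositive (vol α : DiffForm n n M) : Prop := ∀ x v, IsPositiveFrame vol x v → 0 < α x v

/-- `α < 0`. -/
def IsNegative (vol α : DiffForm n n M) : Prop := ∀ x v, IsPositiveFrame vol x v → α x v < 0

/-- `α ≥ 0`. -/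
def IsNonneg (vol α : DiffForm n n M) : Prop := ∀ x v, IsPositiveFrame vol x v → 0 ≤ α x v

/-- `α ≤ 0`. -/
def IsNonpos (vol α : DiffForm n n M) : Prop := ∀ x v, IsPositiveFrame vol x v → α x v ≤ 0

/-- The volume element strictly increases along all trajectories: the volume of each positive frame
strictly increases while it is carried along by the flow. -/
def VolumeIncreases (D : Set (ℝ × M)) (φ : ℝ → M → M) (vol : DiffForm n n M) : Prop :=
  ∀ x v, IsPositiveFrame vol x v → StrictMonoOn (fun t => pullback φ vol t x v) (times D x)

/-- The volume element strictly decreases along all trajectories. -/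
def VolumeDecreases (D : Set (ℝ × M)) (φ : ℝ → M → M) (vol : DiffForm n n M) : Prop :=
  ∀ x v, IsPositiveFrame vol x v → StrictAntiOn (fun t => pullback φ vol t x v) (times D x)

/-- The volume element is nondecreasing along all trajectories. -/
def VolumeNondecreasing (D : Set (ℝ × M)) (φ : ℝ → M → M) (vol : DiffForm n n M) : Prop :=
  ∀ x v, IsPositiveFrame vol x v → MonotoneOn (fun t => pullback φ vol t x v) (times D x)

/-- The volume element is nonincreasing along all trajectories. -/
def VolumeNonincreasing (D : Set (ℝ × M)) (φ : ℝ → M → M) (vol : DiffForm n n M) : Prop :=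
  ∀ x v, IsPositiveFrame vol x v → AntitoneOn (fun t => pullback φ vol t x v) (times D x)

/-- The flow is incompressible: all its transformations leave the volume element invariant. -/
def IsIncompressible (D : Set (ℝ × M)) (φ : ℝ → M → M) (vol : DiffForm n n M) : Prop :=
  ∀ t x, (t, x) ∈ D → pullback φ vol t x = vol x

end

end VolumetricFlow

end

/-!
The proof compares the volumes of a set and of its image under the flow.

Write `φ_t^* vol = J_t • vol`; `J` is `volumeRatio`. Since `φ_{t+s} = φ_t ∘ φ_s`, it is a cocycle,
`J_{t+s}(x) = J_t(φ_s x) J_s(x)` (`IsFlow.volumeRatio_add`), whence `J > 0` and Liouville's formula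
`d/ds J_s(x) = div (φ_s x) J_s(x)` (`IsFlow.hasDerivAt_volumeRatio`). So each of the four hypotheses
of the second part makes `J` monotone in time along every trajectory, in the same sense for all of
them.

Given a point `x₀`, choose a relatively compact open set `W` containing `x₀` and the support of the
velocity field. For all small times `t` the map `φ_t` is defined on `W` and permutes it: a trajectory
is either stationary or stays where the field does not vanish (`IsFlow.eq_of_velocity_eq_zero`).
By the change of variables formula, `∫_W |φ_t^* vol| = ∫_W |vol|`, and this is finite
(`tsum_lintegral_density_mapPullback`). As `J_t ≥ 1` on `W`, or `J_t ≤ 1` on `W`, the equality of the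
integrals and the continuity of `J_t` force `J_t = 1` on `W` (`abs_mapPullback_eq_of_bijOn`). Hence
the divergence vanishes at `x₀` (`IsFlow.divergence_eq_zero`), and by Liouville's formula `J = 1`
at all times. The first part follows: a positive rate of expansion, or a strictly increasing volume,
would fall under the second part and yet contradict its conclusion.

The integral over `W` is not taken with respect to a measure on `M`: `W` is cut into finitely many
Borel pieces, each lying in a chart (`exists_partition`), and the integrals of the densities over the
images of the pieces in `ℝⁿ` are added up. Cutting `W` into the pieces `A i ∩ g⁻¹(A j)` reduces the
invariance of the sum under a bijection `g` to the change of variables formula in `ℝⁿ`.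
-/

open scoped Manifold ContDiff

noncomputable section

namespace VolumetricFlow

open MeasureTheory Set Filter Topology

/-! ### Forms and maps in local coordinates -/

section LocalFormulas

variable {n : ℕ} {M : Type*} [TopologicalSpace M] [ChartedSpace (EuclideanSpace ℝ (Fin n)) M]

/-- The pullback `g^* vol` of a form under a map `g : M → M`. -/
def mapPullback {k : ℕ} (g : M → M) (vol : DiffForm n k M) : DiffForm n k M :=
  fun x => (vol (g x)).compContinuousLinearMap (mfderiv (𝓡 n) (𝓡 n) g x)

/-- A map `g : M → M` in the preferred charts at `a` and `b`. -/
def localMap (g : M → M) (a b : M) (y : EuclideanSpace ℝ (Fin n)) : EuclideanSpace ℝ (Fin n) :=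
  extChartAt (𝓡 n) b (g ((extChartAt (𝓡 n) a).symm y))

/-- All tangent spaces are by definition the model space, so a form takes the same value at equal
points on the same tuple of model vectors; this replaces rewriting with `x = x'`, which the dependent
type of the form obstructs. -/
theorem form_congr {k : ℕ} (vol : DiffForm n k M) {x x' : M} (h : x = x')
    (u : Fin k → EuclideanSpace ℝ (Fin n)) :
    (vol x : (EuclideanSpace ℝ (Fin n)) [⋀^Fin k]→L[ℝ] ℝ) u =
      (vol x' : (EuclideanSpace ℝ (Fin n)) [⋀^Fin k]→L[ℝ] ℝ) u := by
  subst h; rfl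

theorem mem_target_of_mem_image {a : M} {B : Set M}
    (hB : B ⊆ (extChartAt (𝓡 n) a).source) {y : EuclideanSpace ℝ (Fin n)}
    (hy : y ∈ extChartAt (𝓡 n) a '' B) :
    y ∈ (extChartAt (𝓡 n) a).target ∧ (extChartAt (𝓡 n) a).symm y ∈ B := by
  obtain ⟨x, hx, rfl⟩ := hy
  refine ⟨(extChartAt (𝓡 n) a).map_source (hB hx), ?_⟩
  rwa [(extChartAt (𝓡 n) a).left_inv (hB hx)]

theorem image_image_extChartAt {g : M → M} {a : M} (b : M) {B : Set M}
    (hB : B ⊆ (extChartAt (𝓡 n) a).source) :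
    extChartAt (𝓡 n) b '' (g '' B) = localMap g a b '' (extChartAt (𝓡 n) a '' B) := by
  rw [image_image, image_image]
  refine image_congr fun x hx => ?_
  simp only [localMap]
  rw [(extChartAt (𝓡 n) a).left_inv (hB hx)]

theorem image_extChartAt_eq {a : M} {B : Set M} (hB : B ⊆ (extChartAt (𝓡 n) a).source) :
    extChartAt (𝓡 n) a '' B = (extChartAt (𝓡 n) a).target ∩ (extChartAt (𝓡 n) a).symm ⁻¹' B :=
  (extChartAt (𝓡 n) a).image_eq_target_inter_inv_preimage hB

/-- The coefficient of a top degree form with respect to the coordinates of the preferred chart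
at `a`. -/
def density (vol : DiffForm n n M) (a : M) (y : EuclideanSpace ℝ (Fin n)) : ℝ :=
  localForm vol a y fun i => EuclideanSpace.basisFun (Fin n) ℝ i

theorem continuousOn_density {vol : DiffForm n n M} (hvol : IsSmoothForm vol) (a : M) :
    ContinuousOn (density vol a) (extChartAt (𝓡 n) a).target := by
  have h := (hvol a).continuousOn
  exact (ContinuousAlternatingMap.apply ℝ (EuclideanSpace ℝ (Fin n)) ℝ
    (fun i => EuclideanSpace.basisFun (Fin n) ℝ i)).continuous.comp_continuousOn h

theorem injOn_localMap {g : M → M} {a b : M} {B : Set M}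
    (hB : B ⊆ (extChartAt (𝓡 n) a).source) (hinj : InjOn g B)
    (hgB : MapsTo g B (extChartAt (𝓡 n) b).source) :
    InjOn (localMap g a b) (extChartAt (𝓡 n) a '' B) := by
  intro y hy z hz h
  obtain ⟨hy1, hy2⟩ := mem_target_of_mem_image hB hy
  obtain ⟨hz1, hz2⟩ := mem_target_of_mem_image hB hz
  exact (extChartAt (𝓡 n) a).symm.injOn hy1 hz1
    (hinj hy2 hz2 ((extChartAt (𝓡 n) b).injOn (hgB hy2) (hgB hz2) h))

variable [IsManifold (𝓡 n) ∞ M]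

theorem mdifferentiableAt_extChartAt_symm {a : M} {y : EuclideanSpace ℝ (Fin n)}
    (hy : y ∈ (extChartAt (𝓡 n) a).target) :
    MDifferentiableAt 𝓘(ℝ, EuclideanSpace ℝ (Fin n)) (𝓡 n) (extChartAt (𝓡 n) a).symm y :=
  ((contMDiffOn_extChartAt_symm (n := ∞) a).contMDiffAt
    ((isOpen_extChartAt_target a).mem_nhds hy)).mdifferentiableAt (by simp)

theorem mdifferentiableAt_localMap {g : M → M} {a b : M} {y : EuclideanSpace ℝ (Fin n)}
    (hy : y ∈ (extChartAt (𝓡 n) a).target)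
    (hg : MDifferentiableAt (𝓡 n) (𝓡 n) g ((extChartAt (𝓡 n) a).symm y))
    (hb : g ((extChartAt (𝓡 n) a).symm y) ∈ (extChartAt (𝓡 n) b).source) :
    DifferentiableAt ℝ (localMap g a b) y := by
  have h1 := mdifferentiableAt_extChartAt_symm hy
  have h2 : MDifferentiableAt (𝓡 n) 𝓘(ℝ, EuclideanSpace ℝ (Fin n)) (extChartAt (𝓡 n) b)
      (g ((extChartAt (𝓡 n) a).symm y)) :=
    mdifferentiableAt_extChartAt (by simpa using hb)
  exact (h2.comp y (hg.comp y h1)).differentiableAt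

/-- In charts, the pullback of a form under `g` is the pullback under the local expression
of `g`. -/
theorem localForm_mapPullback {k : ℕ} (vol : DiffForm n k M) {g : M → M} {a b : M}
    {y : EuclideanSpace ℝ (Fin n)} (hy : y ∈ (extChartAt (𝓡 n) a).target)
    (hg : MDifferentiableAt (𝓡 n) (𝓡 n) g ((extChartAt (𝓡 n) a).symm y))
    (hb : g ((extChartAt (𝓡 n) a).symm y) ∈ (extChartAt (𝓡 n) b).source) :
    localForm (mapPullback g vol) a y =
      (localForm vol b (localMap g a b y)).compContinuousLinearMap
        (fderiv ℝ (localMap g a b) y) := by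
  have h1 := mdifferentiableAt_extChartAt_symm hy
  have hloc := mdifferentiableAt_localMap hy hg hb
  have hmem : localMap g a b y ∈ (extChartAt (𝓡 n) b).target :=
    (extChartAt (𝓡 n) b).map_source hb
  have h2 := mdifferentiableAt_extChartAt_symm hmem
  have hev : (extChartAt (𝓡 n) b).symm ∘ localMap g a b =ᶠ[𝓝 y] g ∘ (extChartAt (𝓡 n) a).symm := by
    have hc : ContinuousAt (g ∘ (extChartAt (𝓡 n) a).symm) y := (hg.comp y h1).continuousAt
    filter_upwards [hc.preimage_mem_nhds ((isOpen_extChartAt_source b).mem_nhds hb)] with z hz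
    exact (extChartAt (𝓡 n) b).left_inv hz
  have hd1 : mfderiv 𝓘(ℝ, EuclideanSpace ℝ (Fin n)) (𝓡 n)
      ((extChartAt (𝓡 n) b).symm ∘ localMap g a b) y =
      (mfderiv 𝓘(ℝ, EuclideanSpace ℝ (Fin n)) (𝓡 n) (extChartAt (𝓡 n) b).symm
        (localMap g a b y)).comp (fderiv ℝ (localMap g a b) y) := by
    rw [mfderiv_comp y h2 hloc.mdifferentiableAt, mfderiv_eq_fderiv]
    rfl
  have hd2 := mfderiv_comp y hg h1
  have hd : (mfderiv 𝓘(ℝ, EuclideanSpace ℝ (Fin n)) (𝓡 n)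
      ((extChartAt (𝓡 n) b).symm ∘ localMap g a b) y :
        EuclideanSpace ℝ (Fin n) →L[ℝ] EuclideanSpace ℝ (Fin n)) =
      mfderiv 𝓘(ℝ, EuclideanSpace ℝ (Fin n)) (𝓡 n) (g ∘ (extChartAt (𝓡 n) a).symm) y :=
    hev.mfderiv_eq
  ext v
  have hz : (extChartAt (𝓡 n) b).symm (localMap g a b y) = g ((extChartAt (𝓡 n) a).symm y) :=
    (extChartAt (𝓡 n) b).left_inv hb
  have hvec : ∀ w : EuclideanSpace ℝ (Fin n),
      (mfderiv (𝓡 n) (𝓡 n) g ((extChartAt (𝓡 n) a).symm y)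
        (mfderiv 𝓘(ℝ, EuclideanSpace ℝ (Fin n)) (𝓡 n) (extChartAt (𝓡 n) a).symm y w) :
          EuclideanSpace ℝ (Fin n)) =
      mfderiv 𝓘(ℝ, EuclideanSpace ℝ (Fin n)) (𝓡 n) (extChartAt (𝓡 n) b).symm
        (localMap g a b y) (fderiv ℝ (localMap g a b) y w) := by
    intro w
    have h := congrArg (fun L : EuclideanSpace ℝ (Fin n) →L[ℝ] EuclideanSpace ℝ (Fin n) => L w)
      (hd1.symm.trans (hd.trans hd2))
    exact h.symm
  refine (form_congr vol hz.symm _).trans ?_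
  exact congrArg (fun u => (vol ((extChartAt (𝓡 n) b).symm (localMap g a b y)) :
    (EuclideanSpace ℝ (Fin n)) [⋀^Fin k]→L[ℝ] ℝ) u) (funext fun i => hvec (v i))

/-- Pulling back a top degree form by an endomorphism multiplies it by the determinant. -/
theorem compContinuousLinearMap_basisFun
    (γ : (EuclideanSpace ℝ (Fin n)) [⋀^Fin n]→L[ℝ] ℝ)
    (A : EuclideanSpace ℝ (Fin n) →L[ℝ] EuclideanSpace ℝ (Fin n)) :
    γ.compContinuousLinearMap A (fun i => EuclideanSpace.basisFun (Fin n) ℝ i) =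
      A.det * γ (fun i => EuclideanSpace.basisFun (Fin n) ℝ i) := by
  set b : Module.Basis (Fin n) ℝ (EuclideanSpace ℝ (Fin n)) :=
    (EuclideanSpace.basisFun (Fin n) ℝ).toBasis with hb_def
  have hb : (fun i => EuclideanSpace.basisFun (Fin n) ℝ i) = b := by
    funext i
    exact (congrFun (OrthonormalBasis.coe_toBasis (EuclideanSpace.basisFun (Fin n) ℝ)) i).symm
  rw [hb]
  have h := congrArg (fun f => f (A ∘ b)) (AlternatingMap.eq_smul_basis_det b γ.toAlternatingMap)
  have h2 : b.det (A ∘ b) = A.det := by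
    have := b.det_comp (A : EuclideanSpace ℝ (Fin n) →ₗ[ℝ] EuclideanSpace ℝ (Fin n)) b
    rw [b.det_self, mul_one] at this
    exact this
  simp only [AlternatingMap.smul_apply, h2, smul_eq_mul] at h
  rw [mul_comm]
  exact h

theorem density_mapPullback (vol : DiffForm n n M) {g : M → M} {a b : M}
    {y : EuclideanSpace ℝ (Fin n)} (hy : y ∈ (extChartAt (𝓡 n) a).target)
    (hg : MDifferentiableAt (𝓡 n) (𝓡 n) g ((extChartAt (𝓡 n) a).symm y))
    (hb : g ((extChartAt (𝓡 n) a).symm y) ∈ (extChartAt (𝓡 n) b).source) :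
    density (mapPullback g vol) a y =
      (fderiv ℝ (localMap g a b) y).det * density vol b (localMap g a b y) := by
  rw [density, localForm_mapPullback vol hy hg hb, compContinuousLinearMap_basisFun]
  rfl

/-- The tangent space at `a` is identified with the model space by the preferred chart at `a`, so at
`a` the differential of this chart is the identity. -/
theorem mfderiv_extChartAt_symm_center (a : M) :
    (mfderiv 𝓘(ℝ, EuclideanSpace ℝ (Fin n)) (𝓡 n) (extChartAt (𝓡 n) a).symm
      (extChartAt (𝓡 n) a a) : EuclideanSpace ℝ (Fin n) →L[ℝ] EuclideanSpace ℝ (Fin n)) =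
      ContinuousLinearMap.id ℝ _ := by
  have h := mdifferentiableAt_extChartAt_symm (mem_extChartAt_target (I := 𝓡 n) a)
  have h' : ∀ A : EuclideanSpace ℝ (Fin n) →L[ℝ] EuclideanSpace ℝ (Fin n),
      A = mfderiv 𝓘(ℝ, EuclideanSpace ℝ (Fin n)) (𝓡 n) (extChartAt (𝓡 n) a).symm
        (extChartAt (𝓡 n) a a) →
      HasFDerivAt (extChartAt (𝓡 n) ((extChartAt (𝓡 n) a).symm (extChartAt (𝓡 n) a a)) ∘
        (extChartAt (𝓡 n) a).symm) A (extChartAt (𝓡 n) a a) := by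
    rintro A rfl
    have h2 := h.hasMFDerivAt.2
    simp only [modelWithCornersSelf_coe, range_id] at h2
    exact hasFDerivWithinAt_univ.1 h2
  rw [extChartAt_to_inv] at h'
  have hid : HasFDerivAt (extChartAt (𝓡 n) a ∘ (extChartAt (𝓡 n) a).symm)
      (ContinuousLinearMap.id ℝ (EuclideanSpace ℝ (Fin n))) (extChartAt (𝓡 n) a a) := by
    refine (hasFDerivAt_id _).congr_of_eventuallyEq ?_
    filter_upwards [(isOpen_extChartAt_target (I := 𝓡 n) a).mem_nhds (mem_extChartAt_target a)]
      with y hy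
    exact (extChartAt (𝓡 n) a).right_inv hy
  exact (h' _ rfl).unique hid

theorem density_center (vol : DiffForm n n M) (a : M) :
    density vol a (extChartAt (𝓡 n) a a) = vol a (coordFrame a) := by
  unfold density localForm
  refine (form_congr vol (extChartAt_to_inv (I := 𝓡 n) a) _).trans ?_
  refine congrArg (fun u => (vol a : (EuclideanSpace ℝ (Fin n)) [⋀^Fin n]→L[ℝ] ℝ) u)
    (funext fun i => ?_)
  exact congrArg (fun L : EuclideanSpace ℝ (Fin n) →L[ℝ] EuclideanSpace ℝ (Fin n) =>
    L (EuclideanSpace.basisFun (Fin n) ℝ i)) (mfderiv_extChartAt_symm_center a)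

/-- The image of a Borel set under an injective continuous map between Borel subsets of Euclidean
space is Borel (Lusin–Souslin), so no regularity of an inverse of `g` is needed. -/
theorem measurableSet_image_image {g : M → M} {a b : M} {B : Set M}
    (hB : B ⊆ (extChartAt (𝓡 n) a).source) (hBm : MeasurableSet (extChartAt (𝓡 n) a '' B))
    (hg : ∀ x ∈ B, MDifferentiableAt (𝓡 n) (𝓡 n) g x) (hinj : InjOn g B)
    (hgB : MapsTo g B (extChartAt (𝓡 n) b).source) :
    MeasurableSet (extChartAt (𝓡 n) b '' (g '' B)) := by
  rw [image_image_extChartAt b hB]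
  refine hBm.image_of_continuousOn_injOn (fun y hy => ?_) (injOn_localMap hB hinj hgB)
  obtain ⟨hy1, hy2⟩ := mem_target_of_mem_image hB hy
  exact (mdifferentiableAt_localMap hy1 (hg _ hy2) (hgB hy2)).continuousAt.continuousWithinAt

/-- Change of variables for the volume of a set, computed in charts. -/
theorem lintegral_density_image (vol : DiffForm n n M) {g : M → M} {a b : M} {B : Set M}
    (hB : B ⊆ (extChartAt (𝓡 n) a).source) (hBm : MeasurableSet (extChartAt (𝓡 n) a '' B))
    (hg : ∀ x ∈ B, MDifferentiableAt (𝓡 n) (𝓡 n) g x) (hinj : InjOn g B)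
    (hgB : MapsTo g B (extChartAt (𝓡 n) b).source) :
    ∫⁻ y in extChartAt (𝓡 n) b '' (g '' B), ‖density vol b y‖ₑ =
      ∫⁻ y in extChartAt (𝓡 n) a '' B, ‖density (mapPullback g vol) a y‖ₑ := by
  have key : ∀ y ∈ extChartAt (𝓡 n) a '' B, y ∈ (extChartAt (𝓡 n) a).target ∧
      (extChartAt (𝓡 n) a).symm y ∈ B := fun y hy => mem_target_of_mem_image hB hy
  rw [image_image_extChartAt b hB, lintegral_image_eq_lintegral_abs_det_fderiv_mul volume hBm
    (fun y hy => (mdifferentiableAt_localMap (key y hy).1 (hg _ (key y hy).2)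
      (hgB (key y hy).2)).hasFDerivAt.hasFDerivWithinAt) (injOn_localMap hB hinj hgB)]
  refine setLIntegral_congr_fun hBm fun y hy => ?_
  rw [density_mapPullback vol (key y hy).1 (hg _ (key y hy).2) (hgB (key y hy).2), enorm_mul,
    ← Real.enorm_eq_ofReal_abs]

end LocalFormulas

/-! ### The volume of a relatively compact open set -/

section Volume

theorem measurableSet_inter_preimage_of_continuousOn {X Y : Type*} [TopologicalSpace X]
    [MeasurableSpace X] [OpensMeasurableSpace X] [TopologicalSpace Y] [MeasurableSpace Y]
    [BorelSpace Y] {f : X → Y} {s : Set X} {t : Set Y} (hf : ContinuousOn f s)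
    (hs : MeasurableSet s) (ht : MeasurableSet t) : MeasurableSet (s ∩ f ⁻¹' t) := by
  have h := (continuousOn_iff_continuous_domRestrict.1 hf).measurable ht
  convert! hs.subtype_image h using 1
  ext x
  simp [and_comm]

/-- If `F i ≤ G i` on `S i` and the sums of the integrals agree and are finite, then `F i = G i` on
each `S i` which is open and on which both functions are continuous. -/
theorem eqOn_of_le_of_tsum_lintegral_eq {ι E : Type*} [TopologicalSpace E] [MeasurableSpace E]
    [BorelSpace E] {μ : Measure E} [μ.IsOpenPosMeasure] {F G : ι → E → ENNReal} {S : ι → Set E}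
    (hS : ∀ i, MeasurableSet (S i)) (hle : ∀ i, ∀ y ∈ S i, F i y ≤ G i y)
    (heq : ∑' i, ∫⁻ y in S i, F i y ∂μ = ∑' i, ∫⁻ y in S i, G i y ∂μ)
    (hfin : ∑' i, ∫⁻ y in S i, F i y ∂μ ≠ ⊤) {j : ι} (hj : IsOpen (S j))
    (hF : ContinuousOn (F j) (S j)) (hG : ContinuousOn (G j) (S j)) :
    EqOn (F j) (G j) (S j) := by
  have hle' : ∀ i, ∫⁻ y in S i, F i y ∂μ ≤ ∫⁻ y in S i, G i y ∂μ := fun i =>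
    setLIntegral_mono' (hS i) (hle i)
  have hGF : ∫⁻ y in S j, G j y ∂μ ≤ ∫⁻ y in S j, F j y ∂μ := by
    by_contra! hlt
    exact (ENNReal.tsum_lt_tsum hfin hle' hlt).ne heq
  refine Measure.eqOn_open_of_ae_eq (μ := μ) ?_ hj hF hG
  refine ae_eq_of_ae_le_of_lintegral_le ?_ (ne_top_of_le_ne_top hfin (ENNReal.le_tsum j))
    (hG.aemeasurable (hS j)) hGF
  exact (ae_restrict_iff' (hS j)).2 (Eventually.of_forall (hle j))

variable {n : ℕ} {M : Type*} [TopologicalSpace M] [ChartedSpace (EuclideanSpace ℝ (Fin n)) M]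

/-- A relatively compact open set is cut into finitely many disjoint Borel pieces, each of which is
relatively compact in the domain of a chart, the piece of a given point being open. -/
theorem exists_partition [MeasurableSpace M] [BorelSpace M] {W : Set M} (hW : IsOpen W)
    (hWc : IsCompact (closure W)) {x₀ : M} (hx₀ : x₀ ∈ W) :
    ∃ (m : ℕ) (c : Fin (m + 1) → M) (A : Fin (m + 1) → Set M),
      (∀ i, MeasurableSet (A i)) ∧ Pairwise (Function.onFun Disjoint A) ∧ ⋃ i, A i = W ∧
      (∀ i, ∃ C, IsCompact C ∧ C ⊆ (extChartAt (𝓡 n) (c i)).source ∧ A i ⊆ C) ∧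
      c 0 = x₀ ∧ IsOpen (A 0) ∧ x₀ ∈ A 0 := by
  have : LocallyCompactSpace M := ChartedSpace.locallyCompactSpace (EuclideanSpace ℝ (Fin n)) M
  have h : ∀ x : M, ∃ C, IsCompact C ∧ x ∈ interior C ∧ C ⊆ (extChartAt (𝓡 n) x).source :=
    fun x => exists_compact_subset (isOpen_extChartAt_source x) (mem_extChartAt_source x)
  choose C hC hxC hCs using h
  obtain ⟨t, -, ht⟩ := hWc.elim_nhds_subcover (fun x => interior (C x))
    (fun x _ => isOpen_interior.mem_nhds (hxC x))
  -- The chart at `x₀` comes first, so that `disjointed` removes nothing from its open piece.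
  let c : Fin (t.card + 1) → M := Fin.cons x₀ fun i => (t.equivFin.symm i : M)
  let f : Fin (t.card + 1) → Set M := fun i => W ∩ interior (C (c i))
  have hf : ∀ i, IsOpen (f i) := fun i => hW.inter isOpen_interior
  have h0 : disjointed f 0 = f 0 := disjointed_bot f
  refine ⟨t.card, c, disjointed f, fun i => ?_, disjoint_disjointed f, ?_, fun i => ?_, rfl, ?_, ?_⟩
  · exact disjointedRec (fun _ _ hs => hs.diff (hf _).measurableSet) (hf i).measurableSet
  · rw [iUnion_disjointed]
    refine subset_antisymm (iUnion_subset fun i => inter_subset_left) fun x hx => ?_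
    obtain ⟨z, hz, hxz⟩ := mem_iUnion₂.1 (ht (subset_closure hx))
    refine mem_iUnion.2 ⟨(t.equivFin ⟨z, hz⟩).succ, hx, ?_⟩
    simpa [c] using hxz
  · exact ⟨C (c i), hC _, hCs _,
      (disjointed_subset f i).trans (inter_subset_right.trans interior_subset)⟩
  · rw [h0]; exact hf 0
  · rw [h0]; exact ⟨hx₀, hxC x₀⟩

theorem measurableSet_image_extChartAt [MeasurableSpace M] [BorelSpace M] {a : M} {B : Set M}
    (hB : B ⊆ (extChartAt (𝓡 n) a).source) (hBm : MeasurableSet B) :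
    MeasurableSet (extChartAt (𝓡 n) a '' B) := by
  rw [image_extChartAt_eq hB]
  exact measurableSet_inter_preimage_of_continuousOn (continuousOn_extChartAt_symm a)
    (isOpen_extChartAt_target a).measurableSet hBm

theorem lintegral_density_lt_top {vol : DiffForm n n M} (hvol : IsSmoothForm vol) {a : M}
    {A C : Set M} (hC : IsCompact C) (hCa : C ⊆ (extChartAt (𝓡 n) a).source) (hAC : A ⊆ C) :
    ∫⁻ y in extChartAt (𝓡 n) a '' A, ‖density vol a y‖ₑ < ⊤ := by
  have hK : IsCompact (extChartAt (𝓡 n) a '' C) :=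
    hC.image_of_continuousOn ((continuousOn_extChartAt a).mono hCa)
  have hsub : extChartAt (𝓡 n) a '' C ⊆ (extChartAt (𝓡 n) a).target :=
    image_subset_iff.2 fun x hx => (extChartAt (𝓡 n) a).map_source (hCa hx)
  exact (lintegral_mono_set (image_mono hAC)).trans_lt
    (((continuousOn_density hvol a).mono hsub).integrableOn_compact hK).2

variable [IsManifold (𝓡 n) ∞ M]

theorem contDiffAt_localMap {g : M → M} {a b : M} {y : EuclideanSpace ℝ (Fin n)}
    (hy : y ∈ (extChartAt (𝓡 n) a).target)
    (hg : ContMDiffAt (𝓡 n) (𝓡 n) ∞ g ((extChartAt (𝓡 n) a).symm y))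
    (hb : g ((extChartAt (𝓡 n) a).symm y) ∈ (extChartAt (𝓡 n) b).source) :
    ContDiffAt ℝ ∞ (localMap g a b) y := by
  have h1 := (contMDiffOn_extChartAt_symm (I := 𝓡 n) (n := ∞) a).contMDiffAt
    ((isOpen_extChartAt_target a).mem_nhds hy)
  have h2 : ContMDiffAt (𝓡 n) 𝓘(ℝ, EuclideanSpace ℝ (Fin n)) ∞ (extChartAt (𝓡 n) b)
      (g ((extChartAt (𝓡 n) a).symm y)) := contMDiffAt_extChartAt' (by simpa using hb)
  exact (h2.comp y (hg.comp y h1)).contDiffAt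

theorem continuousAt_density_mapPullback {vol : DiffForm n n M} (hvol : IsSmoothForm vol)
    {g : M → M} {W : Set M} (hW : IsOpen W) (hg : ContMDiffOn (𝓡 n) (𝓡 n) ∞ g W) {a : M}
    {y : EuclideanSpace ℝ (Fin n)} (hy : y ∈ (extChartAt (𝓡 n) a).target)
    (hyW : (extChartAt (𝓡 n) a).symm y ∈ W) :
    ContinuousAt (density (mapPullback g vol) a) y := by
  set b := g ((extChartAt (𝓡 n) a).symm y) with hb
  have hbs : b ∈ (extChartAt (𝓡 n) b).source := mem_extChartAt_source b
  have hc := (continuousOn_extChartAt_symm (I := 𝓡 n) a).continuousAt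
    ((isOpen_extChartAt_target a).mem_nhds hy)
  have hgc : ContinuousAt (g ∘ (extChartAt (𝓡 n) a).symm) y :=
    (hg.continuousOn.continuousAt (hW.mem_nhds hyW)).comp hc
  have hd := contDiffAt_localMap hy (hg.contMDiffAt (hW.mem_nhds hyW)) hbs
  have hf : ContinuousAt (fderiv ℝ (localMap g a b)) y :=
    (hd.fderiv_right (m := 0) (by simp)).continuousAt
  have hdet : ContinuousAt (fun z => (fderiv ℝ (localMap g a b) z).det) y :=
    ContinuousLinearMap.continuous_det.continuousAt.comp hf
  have hρ : ContinuousAt (fun z => density vol b (localMap g a b z)) y :=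
    ContinuousAt.comp (f := localMap g a b) ((continuousOn_density hvol b).continuousAt
      ((isOpen_extChartAt_target b).mem_nhds ((extChartAt (𝓡 n) b).map_source hbs)))
      hd.continuousAt
  refine (hdet.mul hρ).congr ?_
  filter_upwards [(isOpen_extChartAt_target a).mem_nhds hy, hc.preimage_mem_nhds (hW.mem_nhds hyW),
    hgc.preimage_mem_nhds ((isOpen_extChartAt_source b).mem_nhds hbs)] with z hz hzW hzb
  exact (density_mapPullback vol hz
    ((hg.contMDiffAt (hW.mem_nhds hzW)).mdifferentiableAt (by simp)) hzb).symm

/-- A smooth bijection of `W` preserves the total volume of `W`: with respect to a partition of `W`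
into pieces lying in charts, the volumes defined by `vol` and by `g^* vol` agree. -/
theorem tsum_lintegral_density_mapPullback [MeasurableSpace M] [BorelSpace M]
    (vol : DiffForm n n M) {g : M → M} {W : Set M} (hW : IsOpen W)
    (hg : ContMDiffOn (𝓡 n) (𝓡 n) ∞ g W) (hbij : BijOn g W W) {ι : Type*} [Countable ι]
    {c : ι → M} {A : ι → Set M} (hA : ∀ i, MeasurableSet (A i))
    (hdisj : Pairwise (Function.onFun Disjoint A)) (hU : ⋃ i, A i = W)
    (hAc : ∀ i, A i ⊆ (extChartAt (𝓡 n) (c i)).source) :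
    ∑' i, ∫⁻ y in extChartAt (𝓡 n) (c i) '' A i, ‖density vol (c i) y‖ₑ =
      ∑' i, ∫⁻ y in extChartAt (𝓡 n) (c i) '' A i, ‖density (mapPullback g vol) (c i) y‖ₑ := by
  have hAW : ∀ i, A i ⊆ W := fun i => hU ▸ subset_iUnion A i
  let B : ι → ι → Set M := fun i j => A i ∩ g ⁻¹' A j
  have hBA : ∀ i j, B i j ⊆ A i := fun i j => inter_subset_left
  have hBm : ∀ i j, MeasurableSet (B i j) := fun i j => by
    have h := (hA i).inter (measurableSet_inter_preimage_of_continuousOn hg.continuousOn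
      hW.measurableSet (hA j))
    rwa [← inter_assoc, inter_eq_left.2 (hAW i)] at h
  have hgd : ∀ i j, ∀ x ∈ B i j, MDifferentiableAt (𝓡 n) (𝓡 n) g x := fun i j x hx =>
    (hg.contMDiffAt (hW.mem_nhds (hAW i hx.1))).mdifferentiableAt (by simp)
  have hBinj : ∀ i j, InjOn g (B i j) := fun i j => hbij.injOn.mono ((hBA i j).trans (hAW i))
  have hchart : ∀ i (S T : Set M), S ⊆ (extChartAt (𝓡 n) (c i)).source →
      T ⊆ (extChartAt (𝓡 n) (c i)).source → Disjoint S T →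
      Disjoint (extChartAt (𝓡 n) (c i) '' S) (extChartAt (𝓡 n) (c i) '' T) :=
    fun i S T hS hT h => h.image (extChartAt (𝓡 n) (c i)).injOn hS hT
  have h1 : ∀ i, ∫⁻ y in extChartAt (𝓡 n) (c i) '' A i, ‖density (mapPullback g vol) (c i) y‖ₑ =
      ∑' j, ∫⁻ y in extChartAt (𝓡 n) (c i) '' B i j, ‖density (mapPullback g vol) (c i) y‖ₑ := by
    intro i
    have hAi : A i = ⋃ j, B i j := by
      rw [← inter_iUnion, ← preimage_iUnion, hU, inter_eq_left.2]
      exact fun x hx => hbij.mapsTo (hAW i hx)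
    rw [← lintegral_iUnion, ← image_iUnion, ← hAi]
    · exact fun j => measurableSet_image_extChartAt ((hBA i j).trans (hAc i)) (hBm i j)
    · intro j k hjk
      refine hchart i _ _ ((hBA i j).trans (hAc i)) ((hBA i k).trans (hAc i)) ?_
      exact ((hdisj hjk).preimage g).mono inter_subset_right inter_subset_right
  have h2 : ∀ i j, ∫⁻ y in extChartAt (𝓡 n) (c j) '' (g '' B i j), ‖density vol (c j) y‖ₑ =
      ∫⁻ y in extChartAt (𝓡 n) (c i) '' B i j, ‖density (mapPullback g vol) (c i) y‖ₑ :=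
    fun i j => lintegral_density_image vol ((hBA i j).trans (hAc i))
      (measurableSet_image_extChartAt ((hBA i j).trans (hAc i)) (hBm i j)) (hgd i j) (hBinj i j)
      fun x hx => hAc j hx.2
  have hgB : ∀ i j, g '' B i j ⊆ A j := fun i j => image_subset_iff.2 inter_subset_right
  have h3 : ∀ j, ∫⁻ y in extChartAt (𝓡 n) (c j) '' A j, ‖density vol (c j) y‖ₑ =
      ∑' i, ∫⁻ y in extChartAt (𝓡 n) (c j) '' (g '' B i j), ‖density vol (c j) y‖ₑ := by
    intro j
    have hAj : A j = ⋃ i, g '' B i j := by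
      refine subset_antisymm (fun z hz => ?_) (iUnion_subset fun i => hgB i j)
      obtain ⟨x, hx, rfl⟩ := hbij.surjOn (hAW j hz)
      obtain ⟨i, hi⟩ := mem_iUnion.1 (hU.symm ▸ hx)
      exact mem_iUnion.2 ⟨i, x, ⟨hi, hz⟩, rfl⟩
    rw [← lintegral_iUnion, ← image_iUnion, ← hAj]
    · intro i
      exact measurableSet_image_image ((hBA i j).trans (hAc i))
        (measurableSet_image_extChartAt ((hBA i j).trans (hAc i)) (hBm i j)) (hgd i j) (hBinj i j)
        fun x hx => hAc j hx.2
    · intro i k hik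
      refine hchart j _ _ ((hgB i j).trans (hAc j)) ((hgB k j).trans (hAc j)) ?_
      exact ((hdisj hik).mono inter_subset_left inter_subset_left).image hbij.injOn
        ((hBA i j).trans (hAW i)) ((hBA k j).trans (hAW k))
  simp_rw [h1, h3, h2]
  exact ENNReal.tsum_comm

/-- A smooth bijection of a relatively compact open set which does not decrease (or does not
increase) volumes of frames preserves them up to sign. -/
theorem abs_mapPullback_eq_of_bijOn {vol : DiffForm n n M} (hvol : IsSmoothForm vol) {g : M → M}
    {W : Set M} (hW : IsOpen W) (hWc : IsCompact (closure W))
    (hg : ContMDiffOn (𝓡 n) (𝓡 n) ∞ g W) (hbij : BijOn g W W)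
    (h : (∀ x ∈ W, ∀ v, |vol x v| ≤ |mapPullback g vol x v|) ∨
      (∀ x ∈ W, ∀ v, |mapPullback g vol x v| ≤ |vol x v|)) {x₀ : M} (hx₀ : x₀ ∈ W) :
    |mapPullback g vol x₀ (coordFrame x₀)| = |vol x₀ (coordFrame x₀)| := by
  let : MeasurableSpace M := borel M
  have : BorelSpace M := ⟨rfl⟩
  obtain ⟨m, c, A, hA, hdisj, hU, hC, hc0, hA0, hxA⟩ := exists_partition (n := n) hW hWc hx₀
  choose C hCc hCs hAC using hC
  have hAs : ∀ i, A i ⊆ (extChartAt (𝓡 n) (c i)).source := fun i => (hAC i).trans (hCs i)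
  have hAW : ∀ i, A i ⊆ W := fun i => hU ▸ subset_iUnion A i
  have htot := tsum_lintegral_density_mapPullback vol hW hg hbij hA hdisj hU hAs
  have hfin : ∑' i, ∫⁻ y in extChartAt (𝓡 n) (c i) '' A i, ‖density vol (c i) y‖ₑ ≠ ⊤ := by
    rw [tsum_fintype]
    exact (ENNReal.sum_lt_top.2 fun i _ =>
      lintegral_density_lt_top hvol (hCc i) (hCs i) (hAC i)).ne
  have hS : ∀ i, MeasurableSet (extChartAt (𝓡 n) (c i) '' A i) := fun i =>
    measurableSet_image_extChartAt (hAs i) (hA i)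
  have hmem : ∀ i, ∀ y ∈ extChartAt (𝓡 n) (c i) '' A i,
      y ∈ (extChartAt (𝓡 n) (c i)).target ∧ (extChartAt (𝓡 n) (c i)).symm y ∈ W := by
    intro i y hy
    rw [image_extChartAt_eq (hAs i)] at hy
    exact ⟨hy.1, hAW i hy.2⟩
  have hopen : IsOpen (extChartAt (𝓡 n) (c 0) '' A 0) := by
    rw [image_extChartAt_eq (hAs 0)]
    exact (continuousOn_extChartAt_symm (c 0)).isOpen_inter_preimage
      (isOpen_extChartAt_target (c 0)) hA0
  have hcont : ContinuousOn (fun y => ‖density vol (c 0) y‖ₑ) (extChartAt (𝓡 n) (c 0) '' A 0) :=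
    continuous_enorm.comp_continuousOn
      ((continuousOn_density hvol (c 0)).mono fun y hy => (hmem 0 y hy).1)
  have hcont' : ContinuousOn (fun y => ‖density (mapPullback g vol) (c 0) y‖ₑ)
      (extChartAt (𝓡 n) (c 0) '' A 0) :=
    continuous_enorm.comp_continuousOn fun y hy => (continuousAt_density_mapPullback hvol hW hg
      (hmem 0 y hy).1 (hmem 0 y hy).2).continuousWithinAt
  have heq : EqOn (fun y => ‖density vol (c 0) y‖ₑ)
      (fun y => ‖density (mapPullback g vol) (c 0) y‖ₑ) (extChartAt (𝓡 n) (c 0) '' A 0) := by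
    rcases h with h | h
    · exact eqOn_of_le_of_tsum_lintegral_eq (μ := volume)
        (F := fun i y => ‖density vol (c i) y‖ₑ)
        (G := fun i y => ‖density (mapPullback g vol) (c i) y‖ₑ) hS
        (fun i y hy => enorm_le_iff_norm_le.2 (h _ (hmem i y hy).2 _)) htot hfin hopen hcont hcont'
    · exact (eqOn_of_le_of_tsum_lintegral_eq (μ := volume)
        (G := fun i y => ‖density vol (c i) y‖ₑ)
        (F := fun i y => ‖density (mapPullback g vol) (c i) y‖ₑ) hS
        (fun i y hy => enorm_le_iff_norm_le.2 (h _ (hmem i y hy).2 _)) htot.symm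
        (htot ▸ hfin) hopen hcont' hcont).symm
  have h0 := heq (mem_image_of_mem _ hxA)
  simp only [hc0, density_center] at h0
  rw [enorm_eq_iff_norm_eq] at h0
  exact h0.symm

end Volume

/-! ### The volume ratio of a flow -/

section Flow

variable {n : ℕ} {M : Type*} [TopologicalSpace M] [ChartedSpace (EuclideanSpace ℝ (Fin n)) M]

theorem IsVolumeForm.coordFrame_ne_zero {vol : DiffForm n n M} (hvol : IsVolumeForm vol) (x : M) :
    vol x (coordFrame x) ≠ 0 := by
  intro h
  apply hvol.ne_zero x
  rw [eq_smul_of_topDegree x (vol x) (vol x) (hvol.ne_zero x), h, div_zero, zero_smul]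

/-- The factor by which the flow multiplies the volume of an infinitesimal frame at `x` in time
`t`. -/
def volumeRatio (φ : ℝ → M → M) (vol : DiffForm n n M) (t : ℝ) (x : M) : ℝ :=
  pullback φ vol t x (coordFrame x) / vol x (coordFrame x)

theorem pullback_eq_volumeRatio_smul {vol : DiffForm n n M} (hvol : IsVolumeForm vol)
    (φ : ℝ → M → M) (t : ℝ) (x : M) :
    pullback φ vol t x = volumeRatio φ vol t x • vol x :=
  eq_smul_of_topDegree x _ _ (hvol.ne_zero x)

theorem pullback_apply_eq_volumeRatio_mul {vol : DiffForm n n M} (hvol : IsVolumeForm vol)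
    (φ : ℝ → M → M) (t : ℝ) (x : M) (v : Fin n → TangentSpace (𝓡 n) x) :
    pullback φ vol t x v = volumeRatio φ vol t x * vol x v := by
  rw [pullback_eq_volumeRatio_smul hvol]
  rfl

theorem exists_Ioo_of_isOpen_of_ordConnected {S : Set ℝ} (hS : IsOpen S) (hc : S.OrdConnected)
    {a b : ℝ} (ha : a ∈ S) (hb : b ∈ S) :
    ∃ l u, a ∈ Ioo l u ∧ b ∈ Ioo l u ∧ Ioo l u ⊆ S := by
  obtain ⟨l₁, u₁, h₁, hs₁⟩ := mem_nhds_iff_exists_Ioo_subset.1 (hS.mem_nhds ha)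
  obtain ⟨l₂, u₂, h₂, hs₂⟩ := mem_nhds_iff_exists_Ioo_subset.1 (hS.mem_nhds hb)
  refine ⟨min l₁ l₂, max u₁ u₂, ⟨by simp [h₁.1], by simp [h₁.2]⟩, ⟨by simp [h₂.1], by simp [h₂.2]⟩,
    fun t ht => ?_⟩
  rcases le_total t a with hta | hat <;> rcases le_total t b with htb | hbt
  · rcases min_lt_iff.1 ht.1 with h | h
    · exact hs₁ ⟨h, hta.trans_lt h₁.2⟩
    · exact hs₂ ⟨h, htb.trans_lt h₂.2⟩
  · exact hc.out hb ha ⟨hbt, hta⟩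
  · exact hc.out ha hb ⟨hat, htb⟩
  · rcases lt_max_iff.1 ht.2 with h | h
    · exact hs₁ ⟨h₁.1.trans_le hat, h⟩
    · exact hs₂ ⟨h₂.1.trans_le hbt, h⟩

namespace IsFlow

variable {ξ : ∀ x : M, TangentSpace (𝓡 n) x} {D : Set (ℝ × M)} {φ : ℝ → M → M}

theorem isOpen_times (hφ : IsFlow D φ ξ) (x : M) : IsOpen (times D x) :=
  hφ.isOpen_domain.preimage (by fun_prop : Continuous fun t : ℝ => (t, x))

theorem contMDiffAt (hφ : IsFlow D φ ξ) {t : ℝ} {x : M} (h : (t, x) ∈ D) :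
    ContMDiffAt (𝓡 n) (𝓡 n) ∞ (φ t) x := by
  have h1 := hφ.smooth.contMDiffAt (hφ.isOpen_domain.mem_nhds h)
  have h2 : ContMDiffAt (𝓡 n) (𝓘(ℝ, ℝ).prod (𝓡 n)) ∞ (fun x' : M => (t, x')) x :=
    contMDiffAt_const.prodMk contMDiffAt_id
  exact ContMDiffAt.comp (g := fun p : ℝ × M => φ p.1 p.2) x h1 h2

theorem pullback_add (hφ : IsFlow D φ ξ) {k : ℕ} (vol : DiffForm n k M) {s t : ℝ} {x : M}
    (hs : (s, x) ∈ D) (ht : (t, φ s x) ∈ D) (hts : (t + s, x) ∈ D) (v : Fin k → TangentSpace (𝓡 n) x) :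
    pullback φ vol (t + s) x v =
      pullback φ vol t (φ s x) (fun i => mfderiv (𝓡 n) (𝓡 n) (φ s) x (v i)) := by
  have hev : φ (t + s) =ᶠ[𝓝 x] φ t ∘ φ s := by
    have h1 : ∀ᶠ x' in 𝓝 x, (s, x') ∈ D :=
      (by fun_prop : Continuous fun x' : M => (s, x')).continuousAt.preimage_mem_nhds
        (hφ.isOpen_domain.mem_nhds hs)
    have h2 : ∀ᶠ x' in 𝓝 x, (t, φ s x') ∈ D :=
      (continuousAt_const.prodMk (hφ.contMDiffAt hs).continuousAt).preimage_mem_nhds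
        (hφ.isOpen_domain.mem_nhds ht)
    have h3 : ∀ᶠ x' in 𝓝 x, (t + s, x') ∈ D :=
      (by fun_prop : Continuous fun x' : M => (t + s, x')).continuousAt.preimage_mem_nhds
        (hφ.isOpen_domain.mem_nhds hts)
    filter_upwards [h1, h2, h3] with x' hx1 hx2 hx3
    exact hφ.map_add s t x' hx1 hx2 hx3
  have hd : (mfderiv (𝓡 n) (𝓡 n) (φ (t + s)) x :
      EuclideanSpace ℝ (Fin n) →L[ℝ] EuclideanSpace ℝ (Fin n)) =
      mfderiv (𝓡 n) (𝓡 n) (φ t ∘ φ s) x := hev.mfderiv_eq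
  have hc := mfderiv_comp x ((hφ.contMDiffAt ht).mdifferentiableAt (by simp))
    ((hφ.contMDiffAt hs).mdifferentiableAt (by simp))
  refine (form_congr vol (hφ.map_add s t x hs ht hts) _).trans ?_
  exact congrArg (fun u => (vol (φ t (φ s x)) :
    (EuclideanSpace ℝ (Fin n)) [⋀^Fin k]→L[ℝ] ℝ) u) (funext fun i =>
    congrArg (fun L : EuclideanSpace ℝ (Fin n) →L[ℝ] EuclideanSpace ℝ (Fin n) => L (v i))
      (hd.trans hc))

theorem volumeRatio_zero (hφ : IsFlow D φ ξ) {vol : DiffForm n n M} (hvol : IsVolumeForm vol)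
    (x : M) : volumeRatio φ vol 0 x = 1 := by
  have h0 : φ 0 = id := funext hφ.map_zero
  have h1 : pullback φ vol 0 x (coordFrame x) = vol x (coordFrame x) := by
    refine (form_congr vol (hφ.map_zero x) _).trans ?_
    have hd : (mfderiv (𝓡 n) (𝓡 n) (φ 0) x :
        EuclideanSpace ℝ (Fin n) →L[ℝ] EuclideanSpace ℝ (Fin n)) =
        ContinuousLinearMap.id ℝ (EuclideanSpace ℝ (Fin n)) := by
      rw [h0]; exact mfderiv_id
    exact congrArg (fun u => (vol x : (EuclideanSpace ℝ (Fin n)) [⋀^Fin n]→L[ℝ] ℝ) u)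
      (funext fun i => congrArg (fun L : EuclideanSpace ℝ (Fin n) →L[ℝ] EuclideanSpace ℝ (Fin n) =>
        L (coordFrame x i)) hd)
  rw [volumeRatio, h1, div_self (hvol.coordFrame_ne_zero x)]

theorem volumeRatio_add (hφ : IsFlow D φ ξ) {vol : DiffForm n n M} (hvol : IsVolumeForm vol)
    {s t : ℝ} {x : M} (hs : (s, x) ∈ D) (ht : (t, φ s x) ∈ D) (hts : (t + s, x) ∈ D) :
    volumeRatio φ vol (t + s) x = volumeRatio φ vol t (φ s x) * volumeRatio φ vol s x := by
  have h := hφ.pullback_add vol hs ht hts (coordFrame x)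
  rw [pullback_apply_eq_volumeRatio_mul hvol φ t] at h
  rw [volumeRatio, h, mul_div_assoc]
  rfl

theorem eventually_mem (hφ : IsFlow D φ ξ) (x : M) : ∀ᶠ t in 𝓝 (0 : ℝ), (t, x) ∈ D :=
  (hφ.isOpen_times x).mem_nhds (hφ.zero_mem x)

variable [IsManifold (𝓡 n) ∞ M]

/-- In the chart at `x` and a chart around `φ t x`, the volume ratio is the value on the standard basis
of the pullback of a smooth form under the spatial derivative of a smooth map, up to a constant. -/
theorem differentiableAt_volumeRatio (hφ : IsFlow D φ ξ) {vol : DiffForm n n M}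
    (hvol : IsVolumeForm vol) {t : ℝ} {x : M} (ht : (t, x) ∈ D) :
    DifferentiableAt ℝ (fun t => volumeRatio φ vol t x) t := by
  set y : EuclideanSpace ℝ (Fin n) := extChartAt (𝓡 n) x x with hy
  have hyt : y ∈ (extChartAt (𝓡 n) x).target := mem_extChartAt_target x
  have hyx : (extChartAt (𝓡 n) x).symm y = x := extChartAt_to_inv x
  set b : M := φ t x with hb
  let F : ℝ × EuclideanSpace ℝ (Fin n) → EuclideanSpace ℝ (Fin n) := fun p =>
    localMap (φ p.1) x b p.2
  have hF : ContDiffAt ℝ ∞ F (t, y) := by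
    have h1 : ContMDiffAt 𝓘(ℝ, ℝ × EuclideanSpace ℝ (Fin n)) (𝓘(ℝ, ℝ).prod (𝓡 n)) ∞
        (fun p : ℝ × EuclideanSpace ℝ (Fin n) => (p.1, (extChartAt (𝓡 n) x).symm p.2)) (t, y) := by
      refine contDiff_fst.contMDiff.contMDiffAt.prodMk ?_
      exact ContMDiffAt.comp (I' := 𝓘(ℝ, EuclideanSpace ℝ (Fin n)))
        (g := (extChartAt (𝓡 n) x).symm) (t, y)
        ((contMDiffOn_extChartAt_symm x).contMDiffAt ((isOpen_extChartAt_target x).mem_nhds hyt))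
        contDiff_snd.contMDiff.contMDiffAt
    have h2 : ContMDiffAt (𝓘(ℝ, ℝ).prod (𝓡 n)) (𝓡 n) ∞ (fun p : ℝ × M => φ p.1 p.2)
        (t, (extChartAt (𝓡 n) x).symm y) := by
      rw [hyx]; exact hφ.smooth.contMDiffAt (hφ.isOpen_domain.mem_nhds ht)
    have h3 : ContMDiffAt (𝓡 n) 𝓘(ℝ, EuclideanSpace ℝ (Fin n)) ∞ (extChartAt (𝓡 n) b)
        (φ t ((extChartAt (𝓡 n) x).symm y)) := by
      rw [hyx]; exact contMDiffAt_extChartAt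
    exact (ContMDiffAt.comp (t, y) h3 (ContMDiffAt.comp (t, y) h2 h1)).contDiffAt
  have hline : DifferentiableAt ℝ (fun s : ℝ => (s, y)) t := by fun_prop
  have hmap : DifferentiableAt ℝ (fun s => F (s, y)) t :=
    DifferentiableAt.comp (g := F) t (hF.differentiableAt (by simp)) hline
  have hder : DifferentiableAt ℝ (fun s => (fderiv ℝ F (s, y)).comp
      (ContinuousLinearMap.inr ℝ ℝ (EuclideanSpace ℝ (Fin n)))) t := by
    have h := ((hF.fderiv_right (m := ∞) (by simp)).differentiableAt (by simp)).comp t hline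
    exact h.clm_comp (differentiableAt_const _)
  have hbs : φ t x ∈ (extChartAt (𝓡 n) b).source := mem_extChartAt_source b
  have hform : DifferentiableAt ℝ (fun s => localForm vol b (F (s, y))) t := by
    refine DifferentiableAt.comp t (g := localForm vol b) ?_ hmap
    refine (((hvol.smooth b).contDiffAt ((isOpen_extChartAt_target b).mem_nhds ?_))
      ).differentiableAt (by simp)
    have : F (t, y) = extChartAt (𝓡 n) b b := by simp only [F, localMap, hyx, hb]
    rw [this]
    exact mem_extChartAt_target b
  have hpull := hform.continuousAlternatingMapCompContinuousLinearMap hder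
  have happ : DifferentiableAt ℝ (fun s => ((localForm vol b (F (s, y))).compContinuousLinearMap
      ((fderiv ℝ F (s, y)).comp (ContinuousLinearMap.inr ℝ ℝ (EuclideanSpace ℝ (Fin n)))))
      (fun i => EuclideanSpace.basisFun (Fin n) ℝ i)) t :=
    (ContinuousAlternatingMap.apply ℝ (EuclideanSpace ℝ (Fin n)) ℝ
      (fun i => EuclideanSpace.basisFun (Fin n) ℝ i)).differentiableAt.comp t hpull
  refine (happ.div_const (vol x (coordFrame x))).congr_of_eventuallyEq ?_
  have e1 : ∀ᶠ s in 𝓝 t, (s, x) ∈ D := (hφ.isOpen_times x).mem_nhds ht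
  have e2 : ∀ᶠ s in 𝓝 t, φ s x ∈ (extChartAt (𝓡 n) b).source := by
    have hc : ContinuousAt (fun s => φ s x) t :=
      ContinuousAt.comp (g := fun p : ℝ × M => φ p.1 p.2) (f := fun s : ℝ => (s, x))
        (hφ.smooth.contMDiffAt (hφ.isOpen_domain.mem_nhds ht)).continuousAt (by fun_prop)
    exact hc.preimage_mem_nhds ((isOpen_extChartAt_source b).mem_nhds hbs)
  have e3 : ∀ᶠ s in 𝓝 t, DifferentiableAt ℝ F (s, y) := by
    have h : ∀ᶠ p in 𝓝 (t, y), DifferentiableAt ℝ F p := by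
      filter_upwards [(hF.of_le (m := 1) (by simp)).eventually (by simp)] with p hp
      exact hp.differentiableAt (by simp)
    exact hline.continuousAt.eventually h
  filter_upwards [e1, e2, e3] with s hs1 hs2 hs3
  have hgs : MDifferentiableAt (𝓡 n) (𝓡 n) (φ s) ((extChartAt (𝓡 n) x).symm y) := by
    rw [hyx]; exact (hφ.contMDiffAt hs1).mdifferentiableAt (by simp)
  have hfd : fderiv ℝ (localMap (φ s) x b) y =
      (fderiv ℝ F (s, y)).comp (ContinuousLinearMap.inr ℝ ℝ (EuclideanSpace ℝ (Fin n))) :=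
    (hs3.hasFDerivAt.comp y (hasFDerivAt_prodMk_right s y)).fderiv
  have hd := density_center (mapPullback (φ s) vol) x
  rw [density, localForm_mapPullback vol hyt hgs (by rw [hyx]; exact hs2), hfd] at hd
  rw [volumeRatio]
  exact congrArg (· / vol x (coordFrame x)) hd.symm

theorem lieDerivative_eq_deriv_smul (hφ : IsFlow D φ ξ) {vol : DiffForm n n M}
    (hvol : IsVolumeForm vol) (x : M) :
    lieDerivative φ vol x = deriv (fun t => volumeRatio φ vol t x) 0 • vol x := by
  have key : ∀ (α : (EuclideanSpace ℝ (Fin n)) [⋀^Fin n]→L[ℝ] ℝ) (J : ℝ → ℝ),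
      DifferentiableAt ℝ J 0 → deriv (fun t => J t • α) 0 = deriv J 0 • α :=
    fun α J hJ => (hJ.hasDerivAt.smul_const α).deriv
  have h := key (vol x) _ (hφ.differentiableAt_volumeRatio hvol (hφ.zero_mem x))
  have hf : (fun t => pullback φ vol t x) = fun t => volumeRatio φ vol t x • vol x :=
    funext fun t => pullback_eq_volumeRatio_smul hvol φ t x
  unfold lieDerivative
  rw [hf]
  exact h

theorem divergence_eq_deriv (hφ : IsFlow D φ ξ) {vol : DiffForm n n M}
    (hvol : IsVolumeForm vol) (x : M) :
    divergence φ vol x = deriv (fun t => volumeRatio φ vol t x) 0 := by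
  rw [divergence, hφ.lieDerivative_eq_deriv_smul hvol, ContinuousAlternatingMap.smul_apply,
    smul_eq_mul, mul_div_cancel_right₀ _ (hvol.coordFrame_ne_zero x)]

/-- Liouville's formula: the cocycle property turns the derivative at time `0`, which is the
divergence, into the derivative at any time. -/
theorem hasDerivAt_volumeRatio (hφ : IsFlow D φ ξ) {vol : DiffForm n n M}
    (hvol : IsVolumeForm vol) {s : ℝ} {x : M} (hs : (s, x) ∈ D) :
    HasDerivAt (fun t => volumeRatio φ vol t x)
      (divergence φ vol (φ s x) * volumeRatio φ vol s x) s := by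
  have h0 := (hφ.differentiableAt_volumeRatio hvol (hφ.zero_mem (φ s x))).hasDerivAt
  rw [← hφ.divergence_eq_deriv hvol, ← sub_self s] at h0
  have h1 := (h0.comp_sub_const s s).mul_const (volumeRatio φ vol s x)
  refine h1.congr_of_eventuallyEq ?_
  have htend : Tendsto (fun t : ℝ => t - s) (𝓝 s) (𝓝 0) := by
    have : Continuous fun t : ℝ => t - s := by fun_prop
    simpa using this.tendsto s
  filter_upwards [htend.eventually (hφ.eventually_mem (φ s x)),
    (hφ.isOpen_times x).mem_nhds hs] with t ht htx
  rw [← hφ.volumeRatio_add hvol hs ht (by rwa [sub_add_cancel]), sub_add_cancel]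

/-- The domain of a local flow need not contain `(-t, φ t x)`, so `φ t` is not visibly invertible near
`x`; instead the cocycle property shows that the set of times with positive ratio is closed and open
in the interval of existence. -/
theorem volumeRatio_pos (hφ : IsFlow D φ ξ) {vol : DiffForm n n M}
    (hvol : IsVolumeForm vol) {t : ℝ} {x : M} (ht : (t, x) ∈ D) : 0 < volumeRatio φ vol t x := by
  have hcont : ContinuousOn (fun t => volumeRatio φ vol t x) (times D x) := fun s hs =>
    (hφ.hasDerivAt_volumeRatio hvol hs).continuousAt.continuousWithinAt
  have hsub : times D x ⊆ times D x ∩ (fun t => volumeRatio φ vol t x) ⁻¹' Ioi 0 := by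
    refine (hφ.interval x).isPreconnected.subset_of_closure_inter_subset
      (hcont.isOpen_inter_preimage (hφ.isOpen_times x) isOpen_Ioi)
      ⟨0, hφ.zero_mem x, hφ.zero_mem x, ?_⟩ ?_
    · simp [hφ.volumeRatio_zero hvol]
    · rintro s ⟨hsc, hs⟩
      refine ⟨hs, ?_⟩
      by_contra hneg
      -- Near time `s` the ratio has the sign it has at `s`, by the cocycle property.
      have hev : ∀ᶠ r in 𝓝 (0 : ℝ), 0 < volumeRatio φ vol r (φ s x) := by
        refine (hφ.hasDerivAt_volumeRatio hvol (hφ.zero_mem (φ s x))).continuousAt.eventually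
          (lt_mem_nhds ?_)
        simp [hφ.volumeRatio_zero hvol]
      have htend : Tendsto (fun t : ℝ => t - s) (𝓝 s) (𝓝 0) := by
        have : Continuous fun t : ℝ => t - s := by fun_prop
        simpa using this.tendsto s
      obtain ⟨r, ⟨hr1, hr2⟩, hrD, hr3⟩ := mem_closure_iff_nhds.1 hsc _
        ((htend.eventually hev).and (htend.eventually (hφ.eventually_mem (φ s x))))
      have hadd := hφ.volumeRatio_add hvol hs hr2 (by rwa [sub_add_cancel])
      rw [sub_add_cancel] at hadd
      have hr3' : 0 < volumeRatio φ vol r x := hr3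
      rw [hadd] at hr3'
      exact hneg ((pos_iff_pos_of_mul_pos hr3').1 hr1)
  exact (hsub ht).2

theorem monotoneOn_volumeRatio (hφ : IsFlow D φ ξ) {vol : DiffForm n n M}
    (hvol : IsVolumeForm vol) (h : ∀ x, 0 ≤ divergence φ vol x) (x : M) :
    MonotoneOn (fun t => volumeRatio φ vol t x) (times D x) := by
  have hd : ∀ s ∈ times D x, HasDerivAt (fun t => volumeRatio φ vol t x) _ s := fun s hs =>
    hφ.hasDerivAt_volumeRatio hvol hs
  refine monotoneOn_of_deriv_nonneg (hφ.interval x).convex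
    (fun s hs => (hd s hs).continuousAt.continuousWithinAt)
    (fun s hs => (hd s (interior_subset hs)).differentiableAt.differentiableWithinAt) fun s hs => ?_
  have hsx : (s, x) ∈ D := interior_subset (s := times D x) hs
  rw [(hd s hsx).deriv]
  exact mul_nonneg (h _) (hφ.volumeRatio_pos hvol hsx).le

theorem antitoneOn_volumeRatio (hφ : IsFlow D φ ξ) {vol : DiffForm n n M}
    (hvol : IsVolumeForm vol) (h : ∀ x, divergence φ vol x ≤ 0) (x : M) :
    AntitoneOn (fun t => volumeRatio φ vol t x) (times D x) := by
  have hd : ∀ s ∈ times D x, HasDerivAt (fun t => volumeRatio φ vol t x) _ s := fun s hs =>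
    hφ.hasDerivAt_volumeRatio hvol hs
  refine antitoneOn_of_deriv_nonpos (hφ.interval x).convex
    (fun s hs => (hd s hs).continuousAt.continuousWithinAt)
    (fun s hs => (hd s (interior_subset hs)).differentiableAt.differentiableWithinAt) fun s hs => ?_
  have hsx : (s, x) ∈ D := interior_subset (s := times D x) hs
  rw [(hd s hsx).deriv]
  exact mul_nonpos_of_nonpos_of_nonneg (h _) (hφ.volumeRatio_pos hvol hsx).le

/-- A trajectory which meets a zero of the velocity field is constant. -/
theorem eq_of_velocity_eq_zero [T2Space M] (hφ : IsFlow D φ ξ) (hξ : IsSmoothVectorField ξ)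
    {s t : ℝ} {x : M} (hs : (s, x) ∈ D) (ht : (t, x) ∈ D) (h0 : ξ (φ s x) = 0) :
    φ t x = φ s x := by
  have : IsManifold (𝓡 n) 1 M := IsManifold.of_le (n := ∞) (by simp)
  obtain ⟨l, u, hsI, htI, hsub⟩ :=
    exists_Ioo_of_isOpen_of_ordConnected (hφ.isOpen_times x) (hφ.interval x) hs ht
  have hconst : IsMIntegralCurveOn (fun _ : ℝ => φ s x) ξ (Ioo l u) :=
    (isMIntegralCurve_const h0).isMIntegralCurveOn _
  have h := isMIntegralCurveOn_Ioo_eqOn_of_contMDiff_boundaryless (I := 𝓡 n) hsI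
    (hξ.of_le (by simp)) ((hφ.velocity x).mono hsub) hconst rfl
  exact h htI

/-- If the ratio of volumes is monotone in time along all trajectories, in the same sense, then the
divergence vanishes: for small times the flow permutes a relatively compact open set, whose finite
volume it preserves. -/
theorem divergence_eq_zero [T2Space M] (hφ : IsFlow D φ ξ) (hξ : IsSmoothVectorField ξ)
    (hξc : IsCompactlySupported ξ) {vol : DiffForm n n M} (hvol : IsVolumeForm vol)
    (h : (∀ x, MonotoneOn (fun t => volumeRatio φ vol t x) (times D x)) ∨
      ∀ x, AntitoneOn (fun t => volumeRatio φ vol t x) (times D x)) (x₀ : M) :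
    divergence φ vol x₀ = 0 := by
  have : LocallyCompactSpace M := ChartedSpace.locallyCompactSpace (EuclideanSpace ℝ (Fin n)) M
  obtain ⟨W, hW, hKW, hWc⟩ := exists_isOpen_superset_and_isCompact_closure
    (hξc.union (isCompact_singleton (x := x₀)))
  have hx₀ : x₀ ∈ W := hKW (Or.inr rfl)
  have hξW : ∀ x, ξ x ≠ 0 → x ∈ W := fun x hx => hKW (Or.inl (subset_closure hx))
  obtain ⟨u, v, hu, -, h0u, hWv, huv⟩ := generalized_tube_lemma (isCompact_singleton (x := (0 : ℝ)))
    hWc hφ.isOpen_domain (by rintro ⟨t, x⟩ ⟨rfl, -⟩; exact hφ.zero_mem x)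
  obtain ⟨ε, hε, hεu⟩ := Metric.isOpen_iff.1 hu 0 (h0u rfl)
  have hD : ∀ t, |t| < ε → ∀ x ∈ W, (t, x) ∈ D := fun t ht x hx =>
    huv ⟨hεu (by simpa using ht), hWv (subset_closure hx)⟩
  have hmaps : ∀ t, |t| < ε → MapsTo (φ t) W W := by
    intro t ht x hx
    by_cases h0 : ξ (φ t x) = 0
    · have heq := hφ.eq_of_velocity_eq_zero hξ (hD t ht x hx) (hφ.zero_mem x) h0
      rw [hφ.map_zero] at heq
      exact heq ▸ hx
    · exact hξW _ h0
  have hinv : ∀ t, |t| < ε → LeftInvOn (φ (-t)) (φ t) W := by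
    intro t ht x hx
    have ht' : |-t| < ε := by rwa [abs_neg]
    rw [← hφ.map_add t (-t) x (hD t ht x hx) (hD (-t) ht' _ (hmaps t ht hx))
      (by rw [neg_add_cancel]; exact hφ.zero_mem x), neg_add_cancel, hφ.map_zero]
  have hbij : ∀ t, |t| < ε → BijOn (φ t) W W := by
    intro t ht
    have ht' : |-t| < ε := by rwa [abs_neg]
    have hr : RightInvOn (φ (-t)) (φ t) W := by simpa using hinv (-t) ht'
    exact InvOn.bijOn ⟨hinv t ht, hr⟩ (hmaps t ht) (hmaps (-t) ht')
  have hone : ∀ t, |t| < ε → volumeRatio φ vol t x₀ = 1 := by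
    intro t ht
    have habs : ∀ x ∈ W, ∀ w, |mapPullback (φ t) vol x w| = volumeRatio φ vol t x * |vol x w| := by
      intro x hx w
      have hp := pullback_apply_eq_volumeRatio_mul hvol φ t x w
      change mapPullback (φ t) vol x w = _ at hp
      rw [hp, abs_mul, abs_of_pos (hφ.volumeRatio_pos hvol (hD t ht x hx))]
    have hcmp : (∀ x ∈ W, 1 ≤ volumeRatio φ vol t x) ∨ (∀ x ∈ W, volumeRatio φ vol t x ≤ 1) := by
      rcases h with h | h <;> rcases le_total 0 t with h0 | h0
      · exact Or.inl fun x hx => hφ.volumeRatio_zero hvol x ▸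
          h x (hφ.zero_mem x) (hD t ht x hx) h0
      · exact Or.inr fun x hx => hφ.volumeRatio_zero hvol x ▸
          h x (hD t ht x hx) (hφ.zero_mem x) h0
      · exact Or.inr fun x hx => hφ.volumeRatio_zero hvol x ▸
          h x (hφ.zero_mem x) (hD t ht x hx) h0
      · exact Or.inl fun x hx => hφ.volumeRatio_zero hvol x ▸
          h x (hD t ht x hx) (hφ.zero_mem x) h0
    have hfin := abs_mapPullback_eq_of_bijOn hvol.smooth hW hWc
      (fun x hx => (hφ.contMDiffAt (hD t ht x hx)).contMDiffWithinAt) (hbij t ht)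
      (hcmp.imp (fun hc x hx w => by
          rw [habs x hx]; exact le_mul_of_one_le_left (abs_nonneg _) (hc x hx))
        (fun hc x hx w => by
          rw [habs x hx]; exact mul_le_of_le_one_left (abs_nonneg _) (hc x hx))) hx₀
    rw [habs x₀ hx₀] at hfin
    exact (mul_eq_right₀ (abs_ne_zero.2 (hvol.coordFrame_ne_zero x₀))).1 hfin
  rw [hφ.divergence_eq_deriv hvol]
  -- Both signs of `t` are covered, so the derivative at `0` is that of a constant function.
  have hev : (fun t => volumeRatio φ vol t x₀) =ᶠ[𝓝 0] fun _ => (1 : ℝ) := by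
    filter_upwards [Metric.ball_mem_nhds (0 : ℝ) hε] with t ht
    exact hone t (by simpa using ht)
  rw [hev.deriv_eq, deriv_const]

/-- A flow without divergence is incompressible. -/
theorem volumeRatio_eq_one (hφ : IsFlow D φ ξ) {vol : DiffForm n n M} (hvol : IsVolumeForm vol)
    (h : ∀ x, divergence φ vol x = 0) {t : ℝ} {x : M} (ht : (t, x) ∈ D) :
    volumeRatio φ vol t x = 1 := by
  have hm := hφ.monotoneOn_volumeRatio hvol (fun x => (h x).ge) x
  have ha := hφ.antitoneOn_volumeRatio hvol (fun x => (h x).le) x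
  rw [← hφ.volumeRatio_zero hvol x]
  rcases le_total 0 t with h0 | h0
  · exact le_antisymm (ha (hφ.zero_mem x) ht h0) (hm (hφ.zero_mem x) ht h0)
  · exact le_antisymm (hm ht (hφ.zero_mem x) h0) (ha ht (hφ.zero_mem x) h0)

end IsFlow

end Flow

/-! ### Orientation, and the two parts of the result -/

section Conclusions

variable {n : ℕ} {M : Type*} [TopologicalSpace M] [ChartedSpace (EuclideanSpace ℝ (Fin n)) M]
  {vol : DiffForm n n M}

/-- Every point has a positive frame, as two vectors of a negative frame can be swapped when `2 ≤ n`;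
for `n = 0` there may be none. -/
theorem IsVolumeForm.exists_isPositiveFrame (hn : 2 ≤ n) (hvol : IsVolumeForm vol) (x : M) :
    ∃ v, IsPositiveFrame vol x v := by
  rcases (hvol.coordFrame_ne_zero x).lt_or_gt with h | h
  · have hij : (⟨0, by omega⟩ : Fin n) ≠ ⟨1, by omega⟩ := by simp
    refine ⟨coordFrame x ∘ Equiv.swap ⟨0, by omega⟩ ⟨1, by omega⟩, ?_⟩
    have hs := (vol x).toAlternatingMap.map_swap (coordFrame x) hij
    change vol x _ = -vol x _ at hs
    rw [IsPositiveFrame, hs]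
    exact neg_pos.2 h
  · exact ⟨_, h⟩

variable {φ : ℝ → M → M} {D : Set (ℝ × M)}

theorem divergence_nonneg (hn : 2 ≤ n) (hvol : IsVolumeForm vol)
    (h : IsNonneg vol (lieDerivative φ vol)) (x : M) : 0 ≤ divergence φ vol x := by
  obtain ⟨v, hv⟩ := hvol.exists_isPositiveFrame hn x
  have h1 := h x v hv
  rw [lieDerivative_eq_divergence_smul φ vol hvol] at h1
  exact nonneg_of_mul_nonneg_left h1 hv

theorem divergence_nonpos (hn : 2 ≤ n) (hvol : IsVolumeForm vol)
    (h : IsNonpos vol (lieDerivative φ vol)) (x : M) : divergence φ vol x ≤ 0 := by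
  obtain ⟨v, hv⟩ := hvol.exists_isPositiveFrame hn x
  have h1 := h x v hv
  rw [lieDerivative_eq_divergence_smul φ vol hvol] at h1
  exact nonpos_of_mul_nonpos_left h1 hv

theorem VolumeNondecreasing.monotoneOn_volumeRatio (hn : 2 ≤ n) (hvol : IsVolumeForm vol)
    (h : VolumeNondecreasing D φ vol) (x : M) :
    MonotoneOn (fun t => volumeRatio φ vol t x) (times D x) := by
  obtain ⟨v, hv⟩ := hvol.exists_isPositiveFrame hn x
  intro s hs t ht hst
  have h1 := h x v hv hs ht hst
  simp only [pullback_apply_eq_volumeRatio_mul hvol] at h1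
  exact le_of_mul_le_mul_right h1 hv

theorem VolumeNonincreasing.antitoneOn_volumeRatio (hn : 2 ≤ n) (hvol : IsVolumeForm vol)
    (h : VolumeNonincreasing D φ vol) (x : M) :
    AntitoneOn (fun t => volumeRatio φ vol t x) (times D x) := by
  obtain ⟨v, hv⟩ := hvol.exists_isPositiveFrame hn x
  intro s hs t ht hst
  have h1 := h x v hv hs ht hst
  simp only [pullback_apply_eq_volumeRatio_mul hvol] at h1
  exact le_of_mul_le_mul_right h1 hv

end Conclusions

end VolumetricFlow

end

open VolumetricFlow in
theorem proposition1 {n : ℕ} (hn : 2 ≤ n) {M : Type*} [TopologicalSpace M]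
    [ChartedSpace (EuclideanSpace ℝ (Fin n)) M] [IsManifold (𝓡 n) ∞ M]
    [T2Space M] [SecondCountableTopology M] [ConnectedSpace M]
    (vol : DiffForm n n M) (hvol : IsVolumeForm vol)
    (ξ : ∀ x : M, TangentSpace (𝓡 n) x) (hξ : IsSmoothVectorField ξ)
    (hξc : IsCompactlySupported ξ)
    (D : Set (ℝ × M)) (φ : ℝ → M → M) (hφ : IsFlow D φ ξ) :
    (¬ IsPositive vol (lieDerivative φ vol) ∧ ¬ IsNegative vol (lieDerivative φ vol)) ∧
    (¬ VolumeIncreases D φ vol ∧ ¬ VolumeDecreases D φ vol) ∧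
    ((IsNonneg vol (lieDerivative φ vol) ∨ IsNonpos vol (lieDerivative φ vol) ∨
        VolumeNondecreasing D φ vol ∨ VolumeNonincreasing D φ vol) →
      IsIncompressible D φ vol ∧ (∀ x, lieDerivative φ vol x = 0) ∧
        (∀ x, divergence φ vol x = 0)) := by
  have main : (IsNonneg vol (lieDerivative φ vol) ∨ IsNonpos vol (lieDerivative φ vol) ∨
        VolumeNondecreasing D φ vol ∨ VolumeNonincreasing D φ vol) →
      IsIncompressible D φ vol ∧ (∀ x, lieDerivative φ vol x = 0) ∧
        (∀ x, divergence φ vol x = 0) := by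
    intro h
    have hdiv : ∀ x, divergence φ vol x = 0 := by
      refine hφ.divergence_eq_zero hξ hξc hvol ?_
      rcases h with h | h | h | h
      · exact Or.inl (hφ.monotoneOn_volumeRatio hvol (divergence_nonneg hn hvol h))
      · exact Or.inr (hφ.antitoneOn_volumeRatio hvol (divergence_nonpos hn hvol h))
      · exact Or.inl (h.monotoneOn_volumeRatio hn hvol)
      · exact Or.inr (h.antitoneOn_volumeRatio hn hvol)
    refine ⟨fun t x ht => ?_, fun x => ?_, hdiv⟩
    · rw [pullback_eq_volumeRatio_smul hvol, hφ.volumeRatio_eq_one hvol hdiv ht, one_smul]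
    · rw [lieDerivative_eq_divergence_smul φ vol hvol, hdiv, zero_smul]
  obtain ⟨x⟩ : Nonempty M := inferInstance
  obtain ⟨v, hv⟩ := hvol.exists_isPositiveFrame hn x
  -- A strictly monotone function of time cannot be constant, as `times D x` contains times `t ≠ 0`.
  obtain ⟨t, ht0, ht⟩ : ∃ t, 0 < t ∧ t ∈ times D x := by
    obtain ⟨ε, hε, hsub⟩ := Metric.isOpen_iff.1 (hφ.isOpen_times x) 0 (hφ.zero_mem x)
    refine ⟨ε / 2, by positivity, hsub ?_⟩
    rw [Metric.mem_ball, dist_zero_right, Real.norm_eq_abs, abs_of_pos (by positivity)]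
    linarith
  refine ⟨⟨fun h => ?_, fun h => ?_⟩, ⟨fun h => ?_, fun h => ?_⟩, main⟩
  · have h1 := h x v hv
    rw [(main (Or.inl fun y w hw => (h y w hw).le)).2.1 x] at h1
    exact lt_irrefl _ h1
  · have h1 := h x v hv
    rw [(main (Or.inr (Or.inl fun y w hw => (h y w hw).le))).2.1 x] at h1
    exact lt_irrefl _ h1
  · have h1 := h x v hv (hφ.zero_mem x) ht ht0
    have hi := (main (Or.inr (Or.inr (Or.inl fun y w hw => (h y w hw).monotoneOn)))).1
    simp only [hi 0 x (hφ.zero_mem x), hi t x ht] at h1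
    exact lt_irrefl _ h1
  · have h1 := h x v hv (hφ.zero_mem x) ht ht0
    have hi := (main (Or.inr (Or.inr (Or.inr fun y w hw => (h y w hw).antitoneOn)))).1
    simp only [hi 0 x (hφ.zero_mem x), hi t x ht] at h1
    exact lt_irrefl _ h1
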